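/- There is an absolute constant $C>0$ such that the following holds. Let $d\ge 1$, let $h_0=m,h_1,\dots,h_d=n$ be the layer widths, let $M_1^{1,\infty},\dots,M_d^{1,\infty}\ge 0$, let $\sigma:\mathbb R\to\mathbb R$ be $L$-Lipschitz with $\sigma(0)=0$ (applied elementwise to vectors), let $p\in[1,\infty]$ (with $1/\infty=0$) and $\epsilon\ge 0$. For a matrix $A$ let $\|A\|_{a,b}$ be the $\ell_b$-norm of the vector of $\ell_a$-norms of the rows of $A$. Let $$\mathcal F=\Big\{x\mapsto W_d\,\sigma(W_{d-1}\,\sigma(\cdots\sigma(W_1x)))\ :\ W_l\in\mathbb R^{h_l\times h_{l-1}},\ \|W_l\|_{1,\infty}\le M_l^{1,\infty},\ l=1,\dots,d\Big\},$$ let $\mathcal U(x)=\{x'\in\mathbb R^m:\|x'-x\|_p\le\epsilon\}$ be the $\ell_p$ attack, and let $$\mathcal H=\Big\{(x,x^+,x^-)\mapsto\min_{x'\in\mathcal U(x)}f(x')^T\big(f(x^+)-f(x^-)\big)\ :\ f\in\mathcal F\Big\}.$$ Let $\mathcal S=\{z_i\}_{i=1}^M=\{(x_i,x_i^+,x_i^-)\}_{i=1}^M$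 be any training set of triples of points of $\mathbb R^m$, let $X,X^+,X^-$ be the matrices with rows $x_i,x_i^+,x_i^-$ respectively, and let $$\mathcal R_{\mathcal S}(\mathcal H)=\mathbb E_{s\sim\mathrm{unif}(\{\pm1\}^M)}\Big[\sup_{g\in\mathcal H}\sum_{i=1}^M s_i\,g(z_i)\Big].$$ Then the minima that define $\mathcal H$ are attained, the suprema in $\mathcal R_{\mathcal S}(\mathcal H)$ are finite, and $$\mathcal R_{\mathcal S}(\mathcal H)\le C\,\sqrt{\sum_{l=1}^d h_lh_{l-1}}\;\sqrt{d\,K_0K_1}\;\sqrt M,$$ where $$K_0=2B^{1,\infty}_{X,\epsilon}\big(B'_{X^+}+B'_{X^-}\big),\qquad K_1=\frac{K_0}{2}+B'_{X,\epsilon}\big(B^{1,\infty}_{X^+}+B^{1,\infty}_{X^-}\big),$$ and, for $Y\in\{X,X^+,X^-\}$, $$B'_{Y}=L^{d-1}\Big(\prod_{l=1}^d h_lM_l^{1,\infty}\Big)m^{1-\frac1p}\,\|Y\|_{p,\infty},\qquad B^{1,\infty}_{Y}=L^{d-1}\Big(\prod_{l=1}^d M_l^{1,\infty}\Big)\|Y\|_{p,\infty},$$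 and $B'_{X,\epsilon}$, $B^{1,\infty}_{X,\epsilon}$ are obtained from $B'_X$, $B^{1,\infty}_X$ by replacing $\|X\|_{p,\infty}$ with $\|X\|_{p,\infty}+\epsilon$. -/

import Mathlib

open scoped ENNReal NNReal Matrix

namespace AdvContrastive

noncomputable section

/-- The `ℓ_p` norm on `ℝⁿ`, for `p ∈ [1, ∞]`. -/
def lpNorm {n : ℕ} (p : ℝ≥0∞) (x : Fin n → ℝ) : ℝ := ‖WithLp.toLp p x‖

/-- The norm `‖A‖_{a,b}`: the `ℓ_b` norm of the vector of `ℓ_a` norms of the rows of `A`. -/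
def mixedNorm {k n : ℕ} (a b : ℝ≥0∞) (A : Matrix (Fin k) (Fin n) ℝ) : ℝ :=
  lpNorm b (fun i => lpNorm a (A i))

/-- The weights of a fully connected network with layer widths `h 0, h 1, h 2, …`. The matrix
`W l` is the one that maps layer `l` to layer `l + 1`, that is `W_{l+1} ∈ ℝ^{h_{l+1} × h_l}` in
the notation in which layers are numbered from `1`. -/
abbrev Weights (h : ℕ → ℕ) : Type := (l : ℕ) → Matrix (Fin (h (l + 1))) (Fin (h l)) ℝ

/-- The input of layer `l + 1`: `x` itself for `l = 0`, and `φ (W_l φ (W_{l-1} ⋯ φ (W_1 x)))`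
for `l ≥ 1`, where `φ` acts elementwise. -/
def hidden (φ : ℝ → ℝ) {h : ℕ → ℕ} (W : Weights h) (x : Fin (h 0) → ℝ) :
    (l : ℕ) → Fin (h l) → ℝ
  | 0 => x
  | l + 1 => fun i => φ ((W l *ᵥ hidden φ W x l) i)

/-- The depth-`d` network `x ↦ W_d φ (W_{d-1} φ (⋯ φ (W_1 x)))` (no activation after the last
layer). Only the first `d` matrices of `W` are used. -/
def network (φ : ℝ → ℝ) {h : ℕ → ℕ} (W : Weights h) :
    (d : ℕ) → (Fin (h 0) → ℝ) → Fin (h d) → ℝ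
  | 0 => fun x => x
  | d + 1 => fun x => W d *ᵥ hidden φ W x d

/-- The class `𝓕` of depth-`d` networks with `‖W_l‖_{1,∞} ≤ M_l` for `l = 1, …, d`; the bound for
`W l` (which is `W_{l+1}`) is `Mw l`. -/
def networkClass (φ : ℝ → ℝ) (d : ℕ) (h : ℕ → ℕ) (Mw : ℕ → ℝ) :
    Set ((Fin (h 0) → ℝ) → Fin (h d) → ℝ) :=
  {f | ∃ W : Weights h, (∀ l < d, mixedNorm 1 ∞ (W l) ≤ Mw l) ∧ f = network φ W d}

/-- The neighbourhood `𝓤(x) = {x' | ‖x' - x‖_p ≤ ε}` of the `ℓ_p` attack. -/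
def attackSet {m : ℕ} (p : ℝ≥0∞) (ε : ℝ) (x : Fin m → ℝ) : Set (Fin m → ℝ) :=
  {x' | lpNorm p (x' - x) ≤ ε}

/-- Triples `(x, x⁺, x⁻)` of points of `ℝᵐ`. -/
abbrev Triple (m : ℕ) : Type := (Fin m → ℝ) × (Fin m → ℝ) × (Fin m → ℝ)

/-- The set of values `f(x')ᵀ (f(x⁺) - f(x⁻))`, `x' ∈ 𝓤(x)`. -/
def attackedValues {m n : ℕ} (p : ℝ≥0∞) (ε : ℝ) (f : (Fin m → ℝ) → Fin n → ℝ) (z : Triple m) :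
    Set ℝ :=
  (fun x' => f x' ⬝ᵥ (f z.2.1 - f z.2.2)) '' attackSet p ε z.1

/-- `(x, x⁺, x⁻) ↦ min_{x' ∈ 𝓤(x)} f(x')ᵀ (f(x⁺) - f(x⁻))`. -/
def advMargin {m n : ℕ} (p : ℝ≥0∞) (ε : ℝ) (f : (Fin m → ℝ) → Fin n → ℝ) : Triple m → ℝ :=
  fun z => sInf (attackedValues p ε f z)

/-- The class `𝓗` obtained from a class `𝓕` of representations. -/
def marginClass {m n : ℕ} (p : ℝ≥0∞) (ε : ℝ) (F : Set ((Fin m → ℝ) → Fin n → ℝ)) :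
    Set (Triple m → ℝ) :=
  advMargin p ε '' F

/-- The set of values `⟨s, g_{|S}⟩ = ∑ i, s_i g(z_i)`, `g ∈ H`, for a vector of signs `s`. -/
def signedSums {Z : Type*} {M : ℕ} (H : Set (Z → ℝ)) (S : Fin M → Z) (s : Fin M → ℤˣ) : Set ℝ :=
  (fun g : Z → ℝ => ∑ i, ((s i : ℤ) : ℝ) * g (S i)) '' H

/-- The (unnormalised) empirical Rademacher complexity
`𝓡_S(H) = 𝔼_{s ∼ unif {±1}^M} sup_{g ∈ H} ⟨s, g_{|S}⟩`. -/
def rademacher {Z : Type*} {M : ℕ} (H : Set (Z → ℝ)) (S : Fin M → Z) : ℝ :=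
  (∑ s : Fin M → ℤˣ, sSup (signedSums H S s)) / 2 ^ M

/-- `L^{d-1} ∏_{l=1}^d M_l · r`. With `r = ‖X‖_{p,∞}` this is `B_X^{1,∞}`, and with
`r = ‖X‖_{p,∞} + ε` it is `B_{X,ε}^{1,∞}`. -/
def boundInf (L : ℝ) (d : ℕ) (Mw : ℕ → ℝ) (r : ℝ) : ℝ :=
  L ^ (d - 1) * (∏ l ∈ Finset.range d, Mw l) * r

/-- `L^{d-1} (∏_{l=1}^d h_l M_l) m^{1-1/p} · r`, `m = h_0`. With `r = ‖X‖_{p,∞}` this is `B'_X`,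
and with `r = ‖X‖_{p,∞} + ε` it is `B'_{X,ε}`. -/
def boundOne (L : ℝ) (d : ℕ) (h : ℕ → ℕ) (Mw : ℕ → ℝ) (p : ℝ≥0∞) (r : ℝ) : ℝ :=
  L ^ (d - 1) * (∏ l ∈ Finset.range d, (h (l + 1) : ℝ) * Mw l)
    * (h 0 : ℝ) ^ (1 - (p⁻¹).toReal) * r

/-- `K₀ = 2 B_{X,ε}^{1,∞} (B'_{X⁺} + B'_{X⁻})`. -/
def K₀ {M : ℕ} (L : ℝ) (d : ℕ) (h : ℕ → ℕ) (Mw : ℕ → ℝ) (p : ℝ≥0∞) (ε : ℝ)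
    (X Xpos Xneg : Matrix (Fin M) (Fin (h 0)) ℝ) : ℝ :=
  2 * boundInf L d Mw (mixedNorm p ∞ X + ε)
    * (boundOne L d h Mw p (mixedNorm p ∞ Xpos) + boundOne L d h Mw p (mixedNorm p ∞ Xneg))

/-- `K₁ = K₀ / 2 + B'_{X,ε} (B_{X⁺}^{1,∞} + B_{X⁻}^{1,∞})`. -/
def K₁ {M : ℕ} (L : ℝ) (d : ℕ) (h : ℕ → ℕ) (Mw : ℕ → ℝ) (p : ℝ≥0∞) (ε : ℝ)
    (X Xpos Xneg : Matrix (Fin M) (Fin (h 0)) ℝ) : ℝ :=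
  K₀ L d h Mw p ε X Xpos Xneg / 2
    + boundOne L d h Mw p (mixedNorm p ∞ X + ε)
      * (boundInf L d Mw (mixedNorm p ∞ Xpos) + boundInf L d Mw (mixedNorm p ∞ Xneg))

end

end AdvContrastive

/-! After the scaling `W_l = M_l V_l`, the class is indexed by the unit ball of a normed space of
dimension `D = ∑ h_l h_{l-1}`, the norm being the maximum over layers and rows of the `ℓ₁` norm
(`networkClass_eq_image`). Let `G V` be the vector of adversarial margins on the sample. In each
coordinate `G` is Lipschitz with constant `A = d K₁` and oscillates by at most `R = K₀`. Both bounds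
are proved at a fixed attacked point by `ℓ_∞`-`ℓ₁` duality (`abs_margin_le`, `abs_margin_sub_le`)
and pass to the minimum over attacks (`abs_advMargin_sub_le`).

The rest is chaining (`signAverage_sSup_closedBall_le`). An increment at scale `16⁻ᵏ` is at most `A
16⁻ᵏ` and at most `R`, hence at most the geometric mean `√(AR) 4⁻ᵏ`. The next net has
log-cardinality at most `6 D 4ᵏ`, so Massart's lemma bounds the step by `√(12 D A R M) 2⁻ᵏ`. The
geometric series sums to at most `7 √(D A R M)`, with no logarithm. -/

namespace AdvContrastive

/-! ### Volumetric nets of the unit ball -/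

/-- A `δ`-separated finite subset of the unit ball has at most `(1 + 2 / δ) ^ dim` points. -/
theorem card_le_of_separated_closedBall {E : Type*} [NormedAddCommGroup E] [NormedSpace ℝ E]
    [FiniteDimensional ℝ E] {δ : ℝ} (hδ : 0 < δ) (s : Finset E) (hs : ∀ c ∈ s, ‖c‖ ≤ 1)
    (h : ∀ c ∈ s, ∀ d ∈ s, c ≠ d → δ ≤ ‖c - d‖) :
    (s.card : ℝ) ≤ (1 + 2 / δ) ^ Module.finrank ℝ E := by
  borelize E
  let μ : MeasureTheory.Measure E := MeasureTheory.Measure.addHaar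
  have hδ2 : 0 < δ / 2 := by positivity
  have ρpos : 0 < 1 + δ / 2 := by positivity
  have D : Set.Pairwise (s : Set E) (Function.onFun Disjoint fun c => Metric.ball (c : E) (δ / 2)) := by
    rintro c hc d hd hcd
    apply Metric.ball_disjoint_ball
    rw [dist_eq_norm]
    linarith [h c hc d hd hcd]
  have A_subset : (⋃ c ∈ s, Metric.ball (c : E) (δ / 2)) ⊆ Metric.ball (0 : E) (1 + δ / 2) := by
    refine Set.iUnion₂_subset fun x hx => ?_
    apply Metric.ball_subset_ball'
    rw [dist_zero_right]
    linarith [hs x hx]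
  have I : (s.card : ℝ≥0∞) * ENNReal.ofReal ((δ / 2) ^ Module.finrank ℝ E) * μ (Metric.ball 0 1) ≤
      ENNReal.ofReal ((1 + δ / 2) ^ Module.finrank ℝ E) * μ (Metric.ball 0 1) :=
    calc
      _ = μ (⋃ c ∈ s, Metric.ball (c : E) (δ / 2)) := by
        rw [MeasureTheory.measure_biUnion_finset D fun c _ => measurableSet_ball]
        simp only [μ.addHaar_ball_of_pos _ hδ2]
        simp only [Finset.sum_const, nsmul_eq_mul, mul_assoc]
      _ ≤ μ (Metric.ball (0 : E) (1 + δ / 2)) := MeasureTheory.measure_mono A_subset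
      _ = _ := by simp only [μ.addHaar_ball_of_pos _ ρpos]
  have J : (s.card : ℝ≥0∞) * ENNReal.ofReal ((δ / 2) ^ Module.finrank ℝ E)
      ≤ ENNReal.ofReal ((1 + δ / 2) ^ Module.finrank ℝ E) :=
    (ENNReal.mul_le_mul_iff_left (Metric.measure_ball_pos _ _ zero_lt_one).ne'
      MeasureTheory.measure_ball_lt_top.ne).1 I
  have K := ENNReal.toReal_le_of_le_ofReal (pow_nonneg ρpos.le _) J
  rw [ENNReal.toReal_mul, ENNReal.toReal_natCast, ENNReal.toReal_ofReal (by positivity)] at K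
  calc (s.card : ℝ) ≤ (1 + δ / 2) ^ Module.finrank ℝ E / (δ / 2) ^ Module.finrank ℝ E :=
        (le_div_iff₀ (by positivity)).2 K
    _ = (1 + 2 / δ) ^ Module.finrank ℝ E := by
        rw [← div_pow]
        congr 1
        field_simp
        ring

/-- The unit ball has a `δ`-net with at most `(1 + 2 / δ) ^ dim` points. -/
theorem exists_finset_net_closedBall (E : Type*) [NormedAddCommGroup E] [NormedSpace ℝ E]
    [FiniteDimensional ℝ E] {δ : ℝ} (hδ : 0 < δ) :
    ∃ s : Finset E, s.Nonempty ∧ (∀ c ∈ s, ‖c‖ ≤ 1) ∧ (∀ v : E, ‖v‖ ≤ 1 → ∃ c ∈ s, ‖v - c‖ ≤ δ) ∧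
      (s.card : ℝ) ≤ (1 + 2 / δ) ^ Module.finrank ℝ E := by
  classical
  -- The volume bound makes these cardinalities bounded. A separated set of maximal cardinality is a
  -- net, since an uncovered point could be added to it.
  let S : Set ℕ := {k | ∃ s : Finset E, s.card = k ∧ (∀ c ∈ s, ‖c‖ ≤ 1) ∧
    ∀ c ∈ s, ∀ d ∈ s, c ≠ d → δ ≤ ‖c - d‖}
  have hne : S.Nonempty := ⟨0, ∅, by simp⟩
  have hbd : BddAbove S := by
    refine ⟨⌊(1 + 2 / δ) ^ Module.finrank ℝ E⌋₊, ?_⟩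
    rintro _ ⟨s, rfl, h1, h2⟩
    exact Nat.le_floor (card_le_of_separated_closedBall hδ s h1 h2)
  obtain ⟨s, hcard, h1, h2⟩ := Nat.sSup_mem hne hbd
  have hcov : ∀ v : E, ‖v‖ ≤ 1 → ∃ c ∈ s, ‖v - c‖ ≤ δ := by
    intro v hv
    by_contra! hcon
    have hvs : v ∉ s := fun hvs => by
      have := hcon v hvs
      simp at this
      linarith
    have hmem : (insert v s).card ∈ S := by
      refine ⟨insert v s, rfl, ?_, ?_⟩
      · simpa using ⟨hv, h1⟩
      · intro c hc d hd hcd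
        rcases Finset.mem_insert.1 hc with rfl | hc' <;> rcases Finset.mem_insert.1 hd with rfl | hd'
        · exact absurd rfl hcd
        · exact (hcon d hd').le
        · rw [norm_sub_rev]
          exact (hcon c hc').le
        · exact h2 c hc' d hd' hcd
    have := le_csSup hbd hmem
    rw [Finset.card_insert_of_notMem hvs] at this
    omega
  obtain ⟨c, hc, -⟩ := hcov 0 (by simp)
  exact ⟨s, ⟨c, hc⟩, h1, hcov, card_le_of_separated_closedBall hδ s h1 h2⟩

/-! ### Averages over signs and Massart's lemma -/

/-- The average over all vectors of signs. -/
noncomputable def signAverage {M : ℕ} (F : (Fin M → ℤˣ) → ℝ) : ℝ := (∑ s, F s) / 2 ^ M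

theorem signAverage_mono {M : ℕ} {F G : (Fin M → ℤˣ) → ℝ} (h : ∀ s, F s ≤ G s) :
    signAverage F ≤ signAverage G := by
  unfold signAverage
  gcongr with s
  exact h s

theorem signAverage_add {M : ℕ} (F G : (Fin M → ℤˣ) → ℝ) :
    signAverage (fun s => F s + G s) = signAverage F + signAverage G := by
  simp [signAverage, Finset.sum_add_distrib, add_div]

theorem signAverage_const {M : ℕ} (c : ℝ) : signAverage (fun _ : Fin M → ℤˣ => c) = c := by
  simp [signAverage]

theorem signAverage_const_mul {M : ℕ} (c : ℝ) (F : (Fin M → ℤˣ) → ℝ) :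
    signAverage (fun s => c * F s) = c * signAverage F := by
  simp [signAverage, ← Finset.mul_sum, mul_div_assoc]

theorem signAverage_sum {M : ℕ} {ι : Type*} (J : Finset ι) (F : ι → (Fin M → ℤˣ) → ℝ) :
    signAverage (fun s => ∑ j ∈ J, F j s) = ∑ j ∈ J, signAverage (F j) := by
  simp only [signAverage]
  rw [Finset.sum_comm, Finset.sum_div]

/-- The signed sum `∑ i, s_i a_i`. -/
def signedSum {M : ℕ} (s : Fin M → ℤˣ) (a : Fin M → ℝ) : ℝ := ∑ i, ((s i : ℤ) : ℝ) * a i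

theorem signedSum_sub {M : ℕ} (s : Fin M → ℤˣ) (a b : Fin M → ℝ) :
    signedSum s (a - b) = signedSum s a - signedSum s b := by
  simp [signedSum, mul_sub]

theorem abs_sign (u : ℤˣ) : |((u : ℤ) : ℝ)| = 1 := by
  rcases Int.units_eq_one_or u with rfl | rfl <;> simp

theorem abs_signedSum_le {M : ℕ} (s : Fin M → ℤˣ) {a : Fin M → ℝ} {r : ℝ} (h : ∀ i, |a i| ≤ r) :
    |signedSum s a| ≤ M * r := by
  calc |signedSum s a| ≤ ∑ i, |((s i : ℤ) : ℝ) * a i| := Finset.abs_sum_le_sum_abs _ _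
    _ ≤ ∑ _i : Fin M, r := Finset.sum_le_sum fun i _ => by rw [abs_mul, abs_sign, one_mul]; exact h i
    _ = M * r := by simp

theorem signAverage_signedSum {M : ℕ} (a : Fin M → ℝ) :
    signAverage (fun s => signedSum s a) = 0 := by
  have h : ∑ s : Fin M → ℤˣ, signedSum s a = ∑ s : Fin M → ℤˣ, signedSum (-s) a :=
    (Equiv.sum_comp (Equiv.neg (Fin M → ℤˣ)) fun s => signedSum s a).symm
  have h2 : ∀ s : Fin M → ℤˣ, signedSum (-s) a = -signedSum s a := by
    intro s
    simp [signedSum]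
  simp only [h2, Finset.sum_neg_distrib] at h
  have : ∑ s : Fin M → ℤˣ, signedSum s a = 0 := by linarith
  simp [signAverage, this]

/-- Independence of the signs factors the exponential moment into a product of `cosh`, and `cosh u ≤
exp (u² / 2)`. -/
theorem signAverage_exp_le {M : ℕ} (a : Fin M → ℝ) {r : ℝ} (h : ∀ i, |a i| ≤ r) (t : ℝ) :
    signAverage (fun s => Real.exp (t * signedSum s a)) ≤ Real.exp (M * (t * r) ^ 2 / 2) := by
  have key : ∑ s : Fin M → ℤˣ, Real.exp (t * signedSum s a)
      = ∏ i, ∑ u : ℤˣ, Real.exp (t * (((u : ℤ) : ℝ) * a i)) := by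
    rw [Fintype.prod_sum]
    refine Finset.sum_congr rfl fun s _ => ?_
    rw [signedSum, Finset.mul_sum, Real.exp_sum]
  have hu : ∀ i, ∑ u : ℤˣ, Real.exp (t * (((u : ℤ) : ℝ) * a i)) ≤ 2 * Real.exp ((t * r) ^ 2 / 2) := by
    intro i
    have : ∑ u : ℤˣ, Real.exp (t * (((u : ℤ) : ℝ) * a i)) = 2 * Real.cosh (t * a i) := by
      rw [show (Finset.univ : Finset ℤˣ) = {1, -1} from rfl, Finset.sum_pair (by decide), Real.cosh_eq]
      simp
      ring
    rw [this]
    have h1 : (t * a i) ^ 2 ≤ (t * r) ^ 2 := by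
      rw [mul_pow, mul_pow]
      exact mul_le_mul_of_nonneg_left (sq_le_sq.2 ((h i).trans (le_abs_self r))) (sq_nonneg t)
    have := Real.cosh_le_exp_half_sq (t * a i)
    have h3 : Real.exp ((t * a i) ^ 2 / 2) ≤ Real.exp ((t * r) ^ 2 / 2) :=
      Real.exp_le_exp.2 (by linarith)
    linarith
  rw [signAverage, key, div_le_iff₀ (by positivity)]
  calc _ ≤ ∏ _i : Fin M, 2 * Real.exp ((t * r) ^ 2 / 2) :=
        Finset.prod_le_prod (fun i _ => Finset.sum_nonneg fun u _ => (Real.exp_pos _).le)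
          fun i _ => hu i
    _ = _ := by
        rw [Finset.prod_const, Finset.card_univ, Fintype.card_fin, mul_pow, ← Real.exp_nat_mul]
        ring_nf

/-- Replaces the optimisation over `t`: for `x ≥ 0` the quadratic `v t² / 2 - x t + q` is
nonnegative on all of `ℝ`, so its discriminant `x² - 2 q v` is at most `0`. This also covers `q = 0`
and `v = 0`. -/
theorem le_sqrt_of_forall_mul_le {x q v : ℝ} (hq : 0 ≤ q) (hv : 0 ≤ v)
    (h : ∀ t : ℝ, 0 < t → t * x ≤ q + v * t ^ 2 / 2) : x ≤ Real.sqrt (2 * q * v) := by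
  rcases lt_or_ge x 0 with hx | hx
  · exact hx.le.trans (Real.sqrt_nonneg _)
  · refine Real.le_sqrt_of_sq_le ?_
    have hd : discrim (v / 2) (-x) q ≤ 0 := by
      refine discrim_le_zero fun t => ?_
      rcases lt_or_ge 0 t with ht | ht
      · have := h t ht
        nlinarith
      · have := mul_nonneg_of_nonpos_of_nonpos ht (neg_nonpos.2 hx)
        have := mul_nonneg hv (mul_self_nonneg t)
        linarith
    rw [discrim] at hd
    linarith

/-- Massart's finite class lemma. -/
theorem signAverage_sup'_le {M : ℕ} {ι : Type*} (J : Finset ι) (hJ : J.Nonempty)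
    (a : ι → Fin M → ℝ) {r q : ℝ} (hq : 0 ≤ q) (ha : ∀ j ∈ J, ∀ i, |a j i| ≤ r)
    (hcard : (J.card : ℝ) ≤ Real.exp q) :
    signAverage (fun s => J.sup' hJ fun j => signedSum s (a j)) ≤ Real.sqrt (2 * q * (M * r ^ 2)) := by
  refine le_sqrt_of_forall_mul_le hq (by positivity) fun t ht => ?_
  -- `exp w` bounds the total exponential moment. Averaging `1 + (t sup - w) ≤ exp (t sup - w)` then
  -- gives `t · average ≤ w`, without Jensen's inequality.
  set w := q + M * r ^ 2 * t ^ 2 / 2 with hw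
  have h1 : ∀ s : Fin M → ℤˣ, 1 + (t * (J.sup' hJ fun j => signedSum s (a j)) + -w)
      ≤ Real.exp (-w) * ∑ j ∈ J, Real.exp (t * signedSum s (a j)) := by
    intro s
    obtain ⟨j, hj, hjs⟩ := J.exists_mem_eq_sup' hJ fun j => signedSum s (a j)
    rw [hjs]
    calc _ ≤ Real.exp (t * signedSum s (a j) + -w) := by
          linarith [Real.add_one_le_exp (t * signedSum s (a j) + -w)]
      _ = Real.exp (-w) * Real.exp (t * signedSum s (a j)) := by rw [Real.exp_add, mul_comm]
      _ ≤ _ := by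
          gcongr
          exact Finset.single_le_sum (f := fun j => Real.exp (t * signedSum s (a j)))
            (fun j _ => (Real.exp_pos _).le) hj
  have h2 := signAverage_mono h1
  rw [signAverage_add, signAverage_add, signAverage_const_mul, signAverage_const_mul,
    signAverage_const, signAverage_const, signAverage_sum] at h2
  have h3 : ∑ j ∈ J, signAverage (fun s => Real.exp (t * signedSum s (a j))) ≤ Real.exp w := by
    calc _ ≤ ∑ _j ∈ J, Real.exp (M * (t * r) ^ 2 / 2) :=
          Finset.sum_le_sum fun j hj => signAverage_exp_le _ (ha j hj) t
      _ = J.card * Real.exp (M * (t * r) ^ 2 / 2) := by simp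
      _ ≤ Real.exp q * Real.exp (M * (t * r) ^ 2 / 2) := by gcongr
      _ = Real.exp w := by
          rw [← Real.exp_add, hw]
          ring_nf
  have h4 : Real.exp (-w) * ∑ j ∈ J, signAverage (fun s => Real.exp (t * signedSum s (a j))) ≤ 1 := by
    calc _ ≤ Real.exp (-w) * Real.exp w := by gcongr
      _ = 1 := by rw [← Real.exp_add]; simp
  linarith

/-! ### Chaining over the unit ball -/

/-- The entropy grows only linearly in `k`; the crude `4 ^ k` is affordable because squared
increments decay like `16⁻ᵏ`. -/
theorem one_add_two_mul_pow_le_exp (k D : ℕ) :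
    (1 + 2 / ((1 / 16 : ℝ) ^ (k + 1))) ^ D ≤ Real.exp (6 * D * 4 ^ k) := by
  have h16 : (16 : ℝ) ≤ Real.exp 3 := by
    have h := Real.exp_one_gt_d9
    calc (16 : ℝ) ≤ 2.7 ^ 3 := by norm_num
      _ ≤ Real.exp 1 ^ 3 := by gcongr; linarith
      _ = Real.exp 3 := by rw [← Real.exp_nat_mul]; norm_num
  have hk : ((k : ℝ) + 2) ≤ 2 * 4 ^ k := by
    have : k + 2 ≤ 2 * 4 ^ k := by
      induction k with
      | zero => norm_num
      | succ k ih => rw [pow_succ]; omega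
    exact_mod_cast this
  have h1 : 1 + 2 / ((1 / 16 : ℝ) ^ (k + 1)) ≤ 16 ^ (k + 2) := by
    have : (1 : ℝ) ≤ 16 ^ (k + 1) := one_le_pow₀ (by norm_num)
    rw [one_div, inv_pow, div_inv_eq_mul, pow_succ 16 (k + 1)]
    linarith
  calc _ ≤ ((16 : ℝ) ^ (k + 2)) ^ D := by gcongr
    _ ≤ (Real.exp 3 ^ (k + 2)) ^ D := by gcongr
    _ = Real.exp (3 * ((k : ℝ) + 2) * D) := by
        rw [← Real.exp_nat_mul, ← Real.exp_nat_mul]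
        push_cast
        ring_nf
    _ ≤ _ := by
        refine Real.exp_le_exp.2 ?_
        have := mul_le_mul_of_nonneg_right hk (Nat.cast_nonneg (α := ℝ) D)
        linarith

/-- The chaining bound for a Lipschitz family of vectors indexed by the unit ball of a
finite-dimensional normed space. -/
theorem signAverage_sSup_closedBall_le {E : Type*} [NormedAddCommGroup E] [NormedSpace ℝ E]
    [FiniteDimensional ℝ E] {M : ℕ} (G : E → Fin M → ℝ) {A R : ℝ} (hA : 0 ≤ A) (hR : 0 ≤ R)
    (hlip : ∀ u v : E, ‖u‖ ≤ 1 → ‖v‖ ≤ 1 → ∀ i, |G u i - G v i| ≤ A * ‖u - v‖)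
    (hbd : ∀ u v : E, ‖u‖ ≤ 1 → ‖v‖ ≤ 1 → ∀ i, |G u i - G v i| ≤ R) :
    signAverage (fun s => sSup ((fun v => signedSum s (G v)) '' {v | ‖v‖ ≤ 1}))
      ≤ 7 * (Real.sqrt (Module.finrank ℝ E) * Real.sqrt (A * R) * Real.sqrt M) := by
  set D := Module.finrank ℝ E with hD
  set B := Real.sqrt D * Real.sqrt (A * R) * Real.sqrt M with hB
  have hB0 : 0 ≤ B := by positivity
  -- Level `0` is the single point `0`, so the chain starts from a signed sum of average zero.
  have hnet : ∀ n : ℕ, ∃ s : Finset E, s.Nonempty ∧ (∀ c ∈ s, ‖c‖ ≤ 1) ∧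
      (∀ v : E, ‖v‖ ≤ 1 → ∃ c ∈ s, ‖v - c‖ ≤ (1 / 16 : ℝ) ^ n) ∧
      (n ≠ 0 → (s.card : ℝ) ≤ (1 + 2 / (1 / 16 : ℝ) ^ n) ^ D) ∧ (n = 0 → s = {0}) := by
    intro n
    rcases Nat.eq_zero_or_pos n with rfl | hn
    · exact ⟨{0}, by simp⟩
    · obtain ⟨s, h1, h2, h3, h4⟩ :=
        exists_finset_net_closedBall E (δ := (1 / 16 : ℝ) ^ n) (by positivity)
      exact ⟨s, h1, h2, h3, fun _ => h4, fun h => absurd h hn.ne'⟩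
  choose T hne hball hcov hcard hzero using hnet
  -- The factor `7 (1 - 2⁻ⁿ)` is the partial sum of the step bounds `(7 / 2) 2⁻ᵏ`.
  have hstep : ∀ n, signAverage (fun s => (T n).sup' (hne n) fun v => signedSum s (G v))
      ≤ 7 * B * (1 - (1 / 2) ^ n) := by
    intro n
    induction n with
    | zero =>
      have : ∀ s : Fin M → ℤˣ, ((T 0).sup' (hne 0) fun v => signedSum s (G v)) = signedSum s (G 0) := by
        intro s
        simp [hzero 0 rfl]
      simp [this, signAverage_signedSum]
    | succ k ih =>
      choose! π hπ hπd using hcov k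
      have h1 : ∀ s : Fin M → ℤˣ, ((T (k + 1)).sup' (hne _) fun v => signedSum s (G v))
          ≤ ((T k).sup' (hne k) fun v => signedSum s (G v))
            + (T (k + 1)).sup' (hne _) fun v => signedSum s (G v - G (π v)) := by
        intro s
        refine Finset.sup'_le _ _ fun v hv => ?_
        have e1 := Finset.le_sup' (fun v => signedSum s (G v)) (hπ v (hball _ v hv))
        have e2 := Finset.le_sup' (fun v => signedSum s (G v - G (π v))) hv
        simp only [signedSum_sub] at e1 e2 ⊢
        linarith
      have h2 : signAverage (fun s => (T (k + 1)).sup' (hne _) fun v => signedSum s (G v - G (π v)))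
          ≤ Real.sqrt (2 * (6 * D * 4 ^ k) * (M * (Real.sqrt (A * R) * (1 / 4) ^ k) ^ 2)) := by
        refine signAverage_sup'_le _ _ _ (by positivity) (fun v hv i => ?_)
          ((hcard (k + 1) (by simp)).trans (one_add_two_mul_pow_le_exp k D))
        have hv1 := hball _ v hv
        have hp1 := hball k _ (hπ v hv1)
        have e1 := (hlip v (π v) hv1 hp1 i).trans (mul_le_mul_of_nonneg_left (hπd v hv1) hA)
        have e2 := hbd v (π v) hv1 hp1 i
        rw [Pi.sub_apply]
        -- Geometric mean: one factor of the square is bounded by the Lipschitz estimate, the other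
        -- by the oscillation.
        refine abs_le_of_sq_le_sq ?_ (by positivity)
        rw [mul_pow, Real.sq_sqrt (by positivity), ← pow_mul, mul_comm k 2, pow_mul, ← sq_abs, sq]
        calc _ ≤ (A * (1 / 16) ^ k) * R := mul_le_mul e1 e2 (abs_nonneg _) (by positivity)
          _ = _ := by norm_num; ring
      have h3 : Real.sqrt (2 * (6 * D * 4 ^ k) * (M * (Real.sqrt (A * R) * (1 / 4) ^ k) ^ 2))
          ≤ 7 / 2 * B * (1 / 2) ^ k := by
        refine Real.sqrt_le_iff.2 ⟨by positivity, ?_⟩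
        have e : (4 : ℝ) ^ k * ((1 / 4) ^ k) ^ 2 = ((1 / 2) ^ k) ^ 2 := by
          rw [← pow_mul, ← pow_mul, mul_comm k 2, pow_mul, pow_mul, ← mul_pow]
          norm_num
        have e2 : B ^ 2 = D * (A * R) * M := by
          rw [hB, mul_pow, mul_pow, Real.sq_sqrt (by positivity), Real.sq_sqrt (by positivity),
            Real.sq_sqrt (by positivity)]
        calc _ = 12 * (D * (A * R) * M) * ((4 : ℝ) ^ k * ((1 / 4) ^ k) ^ 2) := by
              rw [mul_pow, Real.sq_sqrt (by positivity)]
              ring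
          -- This is `√12 ≤ 7 / 2`, the source of the constant `7`.
          _ ≤ 49 / 4 * (D * (A * R) * M) * ((4 : ℝ) ^ k * ((1 / 4) ^ k) ^ 2) := by
              gcongr
              norm_num
          _ = _ := by
              rw [e, ← e2]
              ring
      have h4 := signAverage_mono h1
      rw [signAverage_add] at h4
      rw [pow_succ]
      linarith
  -- Stopping the chain at level `n` costs `M A 16⁻ⁿ`, which vanishes in the limit.
  have hfin : ∀ n : ℕ, signAverage (fun s => sSup ((fun v => signedSum s (G v)) '' {v | ‖v‖ ≤ 1}))
      ≤ 7 * B + M * A * (1 / 16) ^ n := by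
    intro n
    have h1 : ∀ s : Fin M → ℤˣ, sSup ((fun v => signedSum s (G v)) '' {v | ‖v‖ ≤ 1})
        ≤ ((T n).sup' (hne n) fun v => signedSum s (G v)) + M * A * (1 / 16) ^ n := by
      intro s
      refine csSup_le ⟨_, 0, by simp, rfl⟩ ?_
      rintro _ ⟨v, hv, rfl⟩
      obtain ⟨c, hc, hvc⟩ := hcov n v hv
      have e1 := Finset.le_sup' (fun v => signedSum s (G v)) hc
      have e2 := (le_abs_self _).trans (abs_signedSum_le s (a := G v - G c) (r := A * (1 / 16) ^ n)
        fun i => (hlip v c hv (hball _ c hc) i).trans (mul_le_mul_of_nonneg_left hvc hA))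
      simp only [signedSum_sub] at e1 e2 ⊢
      linarith
    have h2 := signAverage_mono h1
    rw [signAverage_add, signAverage_const] at h2
    have := hstep n
    have : 0 ≤ 7 * B * (1 / 2) ^ n := by positivity
    linarith
  have hlim : Filter.Tendsto (fun n : ℕ => 7 * B + M * A * (1 / 16 : ℝ) ^ n) Filter.atTop
      (nhds (7 * B + M * A * 0)) :=
    ((tendsto_pow_atTop_nhds_zero_of_lt_one (by norm_num) (by norm_num)).const_mul _).const_add _
  simpa using ge_of_tendsto' hlim hfin

end AdvContrastive


namespace AdvContrastive

/-! ### Vector and matrix norms -/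

theorem lpNorm_nonneg {n : ℕ} {p : ℝ≥0∞} (hp : 1 ≤ p) (x : Fin n → ℝ) : 0 ≤ lpNorm p x := by
  have : Fact (1 ≤ p) := ⟨hp⟩
  exact norm_nonneg _

theorem lpNorm_top {n : ℕ} (x : Fin n → ℝ) : lpNorm ∞ x = ‖x‖ := by
  simp [lpNorm]

theorem lpNorm_one {n : ℕ} (x : Fin n → ℝ) : lpNorm 1 x = ∑ i, |x i| := by
  simp [lpNorm, PiLp.norm_eq_of_L1]

theorem lpNorm_add_le {n : ℕ} {p : ℝ≥0∞} (hp : 1 ≤ p) (x y : Fin n → ℝ) :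
    lpNorm p (x + y) ≤ lpNorm p x + lpNorm p y := by
  have : Fact (1 ≤ p) := ⟨hp⟩
  exact norm_add_le (WithLp.toLp p x) (WithLp.toLp p y)

theorem norm_le_lpNorm {n : ℕ} {p : ℝ≥0∞} (hp : 1 ≤ p) (x : Fin n → ℝ) : ‖x‖ ≤ lpNorm p x := by
  have : Fact (1 ≤ p) := ⟨hp⟩
  exact (pi_norm_le_iff_of_nonneg (lpNorm_nonneg hp x)).2
    fun i => PiLp.norm_apply_le (WithLp.toLp p x) i

theorem lpNorm_row_le_mixedNorm {k n : ℕ} (p : ℝ≥0∞) (A : Matrix (Fin k) (Fin n) ℝ)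
    (i : Fin k) : lpNorm p (A i) ≤ mixedNorm p ∞ A := by
  rw [mixedNorm, lpNorm_top]
  exact (le_abs_self _).trans (norm_le_pi_norm (fun i => lpNorm p (A i)) i)

theorem mixedNorm_one_top_le_iff {k n : ℕ} (A : Matrix (Fin k) (Fin n) ℝ) {c : ℝ} (hc : 0 ≤ c) :
    mixedNorm 1 ∞ A ≤ c ↔ ∀ i, ∑ j, |A i j| ≤ c := by
  rw [mixedNorm, lpNorm_top, pi_norm_le_iff_of_nonneg hc]
  refine forall_congr' fun i => ?_
  rw [Real.norm_of_nonneg (lpNorm_nonneg le_rfl _), lpNorm_one]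

theorem mixedNorm_nonneg {k n : ℕ} (p : ℝ≥0∞) (A : Matrix (Fin k) (Fin n) ℝ) :
    0 ≤ mixedNorm p ∞ A :=
  lpNorm_nonneg le_top _

/-- The comparison `‖x‖₁ ≤ n^{1 - 1/p} ‖x‖_p`. -/
theorem lpNorm_one_le {n : ℕ} {p : ℝ≥0∞} (hp : 1 ≤ p) (x : Fin n → ℝ) :
    lpNorm 1 x ≤ (n : ℝ) ^ (1 - (p⁻¹).toReal) * lpNorm p x := by
  rw [lpNorm_one]
  rcases eq_or_ne p ∞ with rfl | htop
  · rw [lpNorm_top]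
    calc ∑ i, |x i| ≤ ∑ _i : Fin n, ‖x‖ := Finset.sum_le_sum fun i _ => norm_le_pi_norm x i
      _ = _ := by simp
  · have hq : 1 ≤ p.toReal := by
      have := ENNReal.toReal_mono htop hp
      simpa using this
    have hq0 : 0 < p.toReal := by linarith
    -- Power mean inequality, followed by a `p`-th root.
    have h := Real.rpow_sum_le_const_mul_sum_rpow Finset.univ x hq
    have h2 := Real.rpow_le_rpow (by positivity) h (inv_nonneg.2 hq0.le)
    rw [Real.rpow_rpow_inv (by positivity) hq0.ne', Real.mul_rpow (by positivity) (by positivity),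
      ← Real.rpow_mul (by positivity)] at h2
    rw [lpNorm, PiLp.norm_eq_sum hq0, one_div]
    simp only [Finset.card_univ, Fintype.card_fin] at h2
    convert h2 using 3
    · rw [ENNReal.toReal_inv, sub_mul, mul_inv_cancel₀ hq0.ne', one_mul]
    · simp

theorem abs_dotProduct_le_norm_mul {n : ℕ} (u w : Fin n → ℝ) :
    |u ⬝ᵥ w| ≤ ‖u‖ * lpNorm 1 w := by
  rw [lpNorm_one, dotProduct, Finset.mul_sum]
  refine (Finset.abs_sum_le_sum_abs _ _).trans (Finset.sum_le_sum fun i _ => ?_)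
  rw [abs_mul]
  exact mul_le_mul_of_nonneg_right (norm_le_pi_norm u i) (abs_nonneg _)

theorem abs_dotProduct_le_mul_norm {n : ℕ} (u w : Fin n → ℝ) :
    |u ⬝ᵥ w| ≤ lpNorm 1 u * ‖w‖ := by
  rw [dotProduct_comm, mul_comm]
  exact abs_dotProduct_le_norm_mul w u

theorem norm_mulVec_le {k n : ℕ} (A : Matrix (Fin k) (Fin n) ℝ) {c : ℝ} (hc : 0 ≤ c)
    (hA : ∀ i, ∑ j, |A i j| ≤ c) (x : Fin n → ℝ) : ‖A *ᵥ x‖ ≤ c * ‖x‖ := by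
  refine (pi_norm_le_iff_of_nonneg (by positivity)).2 fun i => ?_
  refine (abs_dotProduct_le_mul_norm (A i) x).trans ?_
  rw [lpNorm_one]
  exact mul_le_mul_of_nonneg_right (hA i) (norm_nonneg x)

/-- Each of the `k` coordinates is at most `c ‖x‖_∞ ≤ c ‖x‖₁`; this is where the widths in `B'` come
from. -/
theorem lpNorm_one_mulVec_le {k n : ℕ} (A : Matrix (Fin k) (Fin n) ℝ) {c : ℝ} (hc : 0 ≤ c)
    (hA : ∀ i, ∑ j, |A i j| ≤ c) (x : Fin n → ℝ) :
    lpNorm 1 (A *ᵥ x) ≤ k * c * lpNorm 1 x := by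
  rw [lpNorm_one (A *ᵥ x)]
  calc _ ≤ ∑ _i : Fin k, c * lpNorm 1 x := Finset.sum_le_sum fun i _ =>
        (norm_le_pi_norm (A *ᵥ x) i).trans ((norm_mulVec_le A hc hA x).trans
          (mul_le_mul_of_nonneg_left (norm_le_lpNorm le_rfl x) hc))
    _ = _ := by simp [mul_assoc]

/-! ### Size and weight-perturbation bounds for networks -/

section Network

variable {h : ℕ → ℕ} {L : ℝ≥0} {φ : ℝ → ℝ} {Mw : ℕ → ℝ} {d : ℕ} {W W' : Weights h}

theorem abs_activation_le (hφ : LipschitzWith L φ) (hφ0 : φ 0 = 0) (t : ℝ) : |φ t| ≤ L * |t| := by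
  simpa [hφ0, Real.dist_eq] using hφ.dist_le_mul t 0

theorem norm_hidden_le (hφ : LipschitzWith L φ) (hφ0 : φ 0 = 0) (hMw : ∀ l < d, 0 ≤ Mw l)
    (hW : ∀ l < d, ∀ i, ∑ j, |W l i j| ≤ Mw l) (x : Fin (h 0) → ℝ) :
    ∀ l ≤ d, ‖hidden φ W x l‖ ≤ L ^ l * (∏ j ∈ Finset.range l, Mw j) * ‖x‖ := by
  intro l
  induction l with
  | zero => simp [hidden]
  | succ l ih =>
    intro hl
    have h0 : 0 ≤ ∏ j ∈ Finset.range (l + 1), Mw j :=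
      Finset.prod_nonneg fun j hj => hMw j (by have := Finset.mem_range.1 hj; omega)
    refine (pi_norm_le_iff_of_nonneg (by positivity)).2 fun i => ?_
    refine (abs_activation_le hφ hφ0 _).trans ?_
    have h1 := (norm_le_pi_norm (W l *ᵥ hidden φ W x l) i).trans
      (norm_mulVec_le (W l) (hMw l hl) (hW l hl) _)
    rw [Real.norm_eq_abs] at h1
    calc _ ≤ L * (Mw l * (L ^ l * (∏ j ∈ Finset.range l, Mw j) * ‖x‖)) :=
          mul_le_mul_of_nonneg_left
            (h1.trans (mul_le_mul_of_nonneg_left (ih (by omega)) (hMw l hl))) L.2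
      _ = _ := by rw [Finset.prod_range_succ]; ring

theorem lpNorm_one_hidden_le (hφ : LipschitzWith L φ) (hφ0 : φ 0 = 0) (hMw : ∀ l < d, 0 ≤ Mw l)
    (hW : ∀ l < d, ∀ i, ∑ j, |W l i j| ≤ Mw l) (x : Fin (h 0) → ℝ) :
    ∀ l ≤ d, lpNorm 1 (hidden φ W x l)
      ≤ L ^ l * (∏ j ∈ Finset.range l, (h (j + 1) : ℝ) * Mw j) * lpNorm 1 x := by
  intro l
  induction l with
  | zero => simp [hidden]
  | succ l ih =>
    intro hl
    have h1 : lpNorm 1 (hidden φ W x (l + 1)) ≤ L * lpNorm 1 (W l *ᵥ hidden φ W x l) := by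
      rw [lpNorm_one, lpNorm_one, Finset.mul_sum]
      exact Finset.sum_le_sum fun i _ => abs_activation_le hφ hφ0 _
    have h2 := lpNorm_one_mulVec_le (W l) (hMw l hl) (hW l hl) (hidden φ W x l)
    have h3 := hMw l hl
    calc _ ≤ L * (h (l + 1) * Mw l
            * (L ^ l * (∏ j ∈ Finset.range l, (h (j + 1) : ℝ) * Mw j) * lpNorm 1 x)) :=
          h1.trans (mul_le_mul_of_nonneg_left
            (h2.trans (mul_le_mul_of_nonneg_left (ih (by omega)) (by positivity))) L.2)
      _ = _ := by rw [Finset.prod_range_succ]; ring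

theorem norm_mulVec_sub_mulVec_le {k n : ℕ} (A A' : Matrix (Fin k) (Fin n) ℝ) {c δ : ℝ} (hc : 0 ≤ c)
    (hδ : 0 ≤ δ) (hA' : ∀ i, ∑ j, |A' i j| ≤ c) (hAA : ∀ i, ∑ j, |A i j - A' i j| ≤ c * δ)
    (x x' : Fin n → ℝ) : ‖A *ᵥ x - A' *ᵥ x'‖ ≤ c * δ * ‖x‖ + c * ‖x - x'‖ := by
  have e : A *ᵥ x - A' *ᵥ x' = (A - A') *ᵥ x + A' *ᵥ (x - x') := by
    rw [Matrix.sub_mulVec, Matrix.mulVec_sub]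
    abel
  rw [e]
  exact (norm_add_le _ _).trans (add_le_add (norm_mulVec_le _ (by positivity) hAA x)
    (norm_mulVec_le _ hc hA' _))

/-- Changing the layers one at a time: a perturbation of `W_l` of relative size `δ` costs `δ` times
the full product bound, whichever the layer, so the `l` layers contribute the factor `l`. -/
theorem norm_hidden_sub_le (hφ : LipschitzWith L φ) (hφ0 : φ 0 = 0) (hMw : ∀ l < d, 0 ≤ Mw l)
    (hW : ∀ l < d, ∀ i, ∑ j, |W l i j| ≤ Mw l) (hW' : ∀ l < d, ∀ i, ∑ j, |W' l i j| ≤ Mw l)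
    {δ : ℝ} (hδ : 0 ≤ δ) (hWW : ∀ l < d, ∀ i, ∑ j, |W l i j - W' l i j| ≤ Mw l * δ)
    (x : Fin (h 0) → ℝ) :
    ∀ l ≤ d, ‖hidden φ W x l - hidden φ W' x l‖
      ≤ l * δ * (L ^ l * (∏ j ∈ Finset.range l, Mw j) * ‖x‖) := by
  intro l
  induction l with
  | zero => simp [hidden]
  | succ l ih =>
    intro hl
    have h0 : 0 ≤ ∏ j ∈ Finset.range (l + 1), Mw j :=
      Finset.prod_nonneg fun j hj => hMw j (by have := Finset.mem_range.1 hj; omega)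
    refine (pi_norm_le_iff_of_nonneg (by positivity)).2 fun i => ?_
    have h1 := (norm_le_pi_norm _ i).trans (norm_mulVec_sub_mulVec_le (W l) (W' l) (hMw l hl) hδ
      (hW' l hl) (hWW l hl) (hidden φ W x l) (hidden φ W' x l))
    have h2 := norm_hidden_le hφ hφ0 hMw hW x l (by omega)
    have h3 := hMw l hl
    have h4 : ‖(hidden φ W x (l + 1) - hidden φ W' x (l + 1)) i‖
        ≤ L * ‖(W l *ᵥ hidden φ W x l - W' l *ᵥ hidden φ W' x l) i‖ := by
      have := hφ.dist_le_mul ((W l *ᵥ hidden φ W x l) i) ((W' l *ᵥ hidden φ W' x l) i)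
      rwa [Real.dist_eq, Real.dist_eq] at this
    calc _ ≤ L * (Mw l * δ * (L ^ l * (∏ j ∈ Finset.range l, Mw j) * ‖x‖)
            + Mw l * (l * δ * (L ^ l * (∏ j ∈ Finset.range l, Mw j) * ‖x‖))) := by
          refine h4.trans (mul_le_mul_of_nonneg_left (h1.trans (add_le_add ?_ ?_)) L.2)
          · exact mul_le_mul_of_nonneg_left h2 (by positivity)
          · exact mul_le_mul_of_nonneg_left (ih (by omega)) h3
      _ = _ := by rw [Finset.prod_range_succ]; push_cast; ring

theorem norm_network_le (hd : 1 ≤ d) (hφ : LipschitzWith L φ) (hφ0 : φ 0 = 0)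
    (hMw : ∀ l < d, 0 ≤ Mw l) (hW : ∀ l < d, ∀ i, ∑ j, |W l i j| ≤ Mw l) (x : Fin (h 0) → ℝ) :
    ‖network φ W d x‖ ≤ boundInf L d Mw ‖x‖ := by
  -- The last layer has no activation, hence `L ^ (d - 1)`.
  obtain ⟨e, rfl⟩ : ∃ e, d = e + 1 := ⟨d - 1, by omega⟩
  have h1 := norm_hidden_le hφ hφ0 hMw hW x e (by omega)
  have he := hMw e (by omega)
  refine (norm_mulVec_le (W e) he (hW e (by omega)) _).trans
    ((mul_le_mul_of_nonneg_left h1 he).trans_eq ?_)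
  rw [boundInf, Finset.prod_range_succ, Nat.add_sub_cancel]
  ring

theorem lpNorm_one_network_le (hd : 1 ≤ d) (hφ : LipschitzWith L φ) (hφ0 : φ 0 = 0)
    (hMw : ∀ l < d, 0 ≤ Mw l) (hW : ∀ l < d, ∀ i, ∑ j, |W l i j| ≤ Mw l) {p : ℝ≥0∞} (hp : 1 ≤ p)
    (x : Fin (h 0) → ℝ) :
    lpNorm 1 (network φ W d x) ≤ boundOne L d h Mw p (lpNorm p x) := by
  obtain ⟨e, rfl⟩ : ∃ e, d = e + 1 := ⟨d - 1, by omega⟩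
  have h1 := lpNorm_one_hidden_le hφ hφ0 hMw hW x e (by omega)
  have he := hMw e (by omega)
  have h0 : 0 ≤ ∏ j ∈ Finset.range e, (h (j + 1) : ℝ) * Mw j :=
    Finset.prod_nonneg fun j hj =>
      mul_nonneg (Nat.cast_nonneg _) (hMw j (by have := Finset.mem_range.1 hj; omega))
  refine (lpNorm_one_mulVec_le (W e) he (hW e (by omega)) _).trans
    ((mul_le_mul_of_nonneg_left (h1.trans
      (mul_le_mul_of_nonneg_left (lpNorm_one_le hp x) (by positivity))) (by positivity)).trans_eq ?_)
  rw [boundOne, Finset.prod_range_succ, Nat.add_sub_cancel]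
  ring

theorem norm_network_sub_le (hd : 1 ≤ d) (hφ : LipschitzWith L φ) (hφ0 : φ 0 = 0)
    (hMw : ∀ l < d, 0 ≤ Mw l) (hW : ∀ l < d, ∀ i, ∑ j, |W l i j| ≤ Mw l)
    (hW' : ∀ l < d, ∀ i, ∑ j, |W' l i j| ≤ Mw l) {δ : ℝ} (hδ : 0 ≤ δ)
    (hWW : ∀ l < d, ∀ i, ∑ j, |W l i j - W' l i j| ≤ Mw l * δ) (x : Fin (h 0) → ℝ) :
    ‖network φ W d x - network φ W' d x‖ ≤ d * δ * boundInf L d Mw ‖x‖ := by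
  obtain ⟨e, rfl⟩ : ∃ e, d = e + 1 := ⟨d - 1, by omega⟩
  have h1 := norm_hidden_le hφ hφ0 hMw hW x e (by omega)
  have h2 := norm_hidden_sub_le hφ hφ0 hMw hW hW' hδ hWW x e (by omega)
  have he := hMw e (by omega)
  refine (norm_mulVec_sub_mulVec_le (W e) (W' e) he hδ (hW' e (by omega)) (hWW e (by omega)) _ _).trans
    ((add_le_add (mul_le_mul_of_nonneg_left h1 (by positivity))
      (mul_le_mul_of_nonneg_left h2 he)).trans_eq ?_)
  rw [boundInf, Finset.prod_range_succ, Nat.add_sub_cancel]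
  push_cast
  ring

theorem continuous_hidden (hφ : Continuous φ) (W : Weights h) (l : ℕ) :
    Continuous fun x => hidden φ W x l := by
  induction l with
  | zero => exact continuous_id
  | succ l ih =>
    exact continuous_pi fun i => hφ.comp
      ((continuous_apply i).comp (Continuous.matrix_mulVec continuous_const ih))

theorem continuous_network (hφ : Continuous φ) (W : Weights h) (d : ℕ) :
    Continuous (network φ W d) := by
  cases d with
  | zero => exact continuous_id
  | succ d => exact Continuous.matrix_mulVec continuous_const (continuous_hidden hφ W d)

theorem boundInf_nonneg (hMw : ∀ l < d, 0 ≤ Mw l) {r : ℝ} (hr : 0 ≤ r) : 0 ≤ boundInf L d Mw r :=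
  mul_nonneg (mul_nonneg (pow_nonneg L.2 _) (Finset.prod_nonneg fun l hl =>
    hMw l (Finset.mem_range.1 hl))) hr

theorem boundOne_nonneg (hMw : ∀ l < d, 0 ≤ Mw l) {p : ℝ≥0∞} {r : ℝ} (hr : 0 ≤ r) :
    0 ≤ boundOne L d h Mw p r :=
  mul_nonneg (mul_nonneg (mul_nonneg (pow_nonneg L.2 _) (Finset.prod_nonneg fun l hl =>
    mul_nonneg (Nat.cast_nonneg _) (hMw l (Finset.mem_range.1 hl)))) (by positivity)) hr

theorem boundInf_mono (hMw : ∀ l < d, 0 ≤ Mw l) {r r' : ℝ} (hr : r ≤ r') :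
    boundInf L d Mw r ≤ boundInf L d Mw r' :=
  mul_le_mul_of_nonneg_left hr (mul_nonneg (pow_nonneg L.2 _) (Finset.prod_nonneg fun l hl =>
    hMw l (Finset.mem_range.1 hl)))

theorem boundOne_mono (hMw : ∀ l < d, 0 ≤ Mw l) {p : ℝ≥0∞} {r r' : ℝ} (hr : r ≤ r') :
    boundOne L d h Mw p r ≤ boundOne L d h Mw p r' :=
  mul_le_mul_of_nonneg_left hr (mul_nonneg (mul_nonneg (pow_nonneg L.2 _)
    (Finset.prod_nonneg fun l hl => mul_nonneg (Nat.cast_nonneg _) (hMw l (Finset.mem_range.1 hl))))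
    (by positivity))

end Network

/-! ### The minimum over the attack set -/

section Attack

variable {m n : ℕ} {p : ℝ≥0∞} {ε : ℝ}

theorem isCompact_attackSet (hp : 1 ≤ p) (ε : ℝ) (x : Fin m → ℝ) : IsCompact (attackSet p ε x) := by
  have : Fact (1 ≤ p) := ⟨hp⟩
  have h : attackSet p ε x = WithLp.ofLp '' Metric.closedBall (WithLp.toLp p x) ε := by
    ext y
    constructor
    · intro hy
      exact ⟨WithLp.toLp p y, by rw [mem_closedBall_iff_norm]; exact hy, rfl⟩
    · rintro ⟨y, hy, rfl⟩
      rw [mem_closedBall_iff_norm] at hy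
      exact hy
  rw [h]
  exact (isCompact_closedBall _ _).image (PiLp.continuous_ofLp p _)

theorem attackSet_nonempty (hp : 1 ≤ p) (hε : 0 ≤ ε) (x : Fin m → ℝ) : (attackSet p ε x).Nonempty := by
  have : Fact (1 ≤ p) := ⟨hp⟩
  exact ⟨x, by simpa [attackSet, lpNorm] using hε⟩

theorem isLeast_advMargin (hp : 1 ≤ p) (hε : 0 ≤ ε) {f : (Fin m → ℝ) → Fin n → ℝ}
    (hf : Continuous f) (z : Triple m) : IsLeast (attackedValues p ε f z) (advMargin p ε f z) :=
  ((isCompact_attackSet hp ε z.1).image (hf.dotProduct continuous_const)).isLeast_sInf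
    ((attackSet_nonempty hp hε z.1).image _)

/-- Each minimum is compared with the other function's value at its own minimiser. -/
theorem abs_advMargin_sub_le (hp : 1 ≤ p) (hε : 0 ≤ ε) {f g : (Fin m → ℝ) → Fin n → ℝ}
    (hf : Continuous f) (hg : Continuous g) (z : Triple m) {c : ℝ}
    (hc : ∀ x ∈ attackSet p ε z.1,
      |f x ⬝ᵥ (f z.2.1 - f z.2.2) - g x ⬝ᵥ (g z.2.1 - g z.2.2)| ≤ c) :
    |advMargin p ε f z - advMargin p ε g z| ≤ c := by
  obtain ⟨⟨x, hx, hxf⟩, hlf⟩ := isLeast_advMargin hp hε hf z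
  obtain ⟨⟨y, hy, hyg⟩, hlg⟩ := isLeast_advMargin hp hε hg z
  have h1 := hlf ⟨y, hy, rfl⟩
  have h2 := hlg ⟨x, hx, rfl⟩
  have h3 := abs_le.1 (hc x hx)
  have h4 := abs_le.1 (hc y hy)
  simp only at hxf hyg h1 h2
  rw [abs_le]
  constructor <;> linarith

theorem lpNorm_le_of_mem_attackSet (hp : 1 ≤ p) {x x' : Fin m → ℝ} (hx : x' ∈ attackSet p ε x) :
    lpNorm p x' ≤ lpNorm p x + ε := by
  have h := lpNorm_add_le hp x (x' - x)
  rw [add_sub_cancel] at h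
  exact h.trans (add_le_add le_rfl hx)

end Attack

theorem norm_sub_le_add {n : ℕ} {x y : Fin n → ℝ} {a b : ℝ} (hx : ‖x‖ ≤ a) (hy : ‖y‖ ≤ b) :
    ‖x - y‖ ≤ a + b :=
  (norm_sub_le x y).trans (add_le_add hx hy)

theorem lpNorm_one_sub_le_add {n : ℕ} {x y : Fin n → ℝ} {a b : ℝ} (hx : lpNorm 1 x ≤ a)
    (hy : lpNorm 1 y ≤ b) : lpNorm 1 (x - y) ≤ a + b :=
  (norm_sub_le (WithLp.toLp 1 x) (WithLp.toLp 1 y)).trans (add_le_add hx hy)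

/-! ### Oscillation and Lipschitz bounds for the margin -/

section Margin

variable {h : ℕ → ℕ} {L : ℝ≥0} {φ : ℝ → ℝ} {Mw : ℕ → ℝ} {d M : ℕ} {W W' : Weights h}
  {p : ℝ≥0∞} {ε : ℝ} (X Xpos Xneg : Matrix (Fin M) (Fin (h 0)) ℝ)

theorem K₀_nonneg (hMw : ∀ l < d, 0 ≤ Mw l) (hε : 0 ≤ ε) : 0 ≤ K₀ L d h Mw p ε X Xpos Xneg :=
  mul_nonneg (mul_nonneg zero_le_two (boundInf_nonneg hMw (add_nonneg (mixedNorm_nonneg _ _) hε)))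
    (add_nonneg (boundOne_nonneg hMw (mixedNorm_nonneg _ _))
      (boundOne_nonneg hMw (mixedNorm_nonneg _ _)))

theorem K₁_nonneg (hMw : ∀ l < d, 0 ≤ Mw l) (hε : 0 ≤ ε) : 0 ≤ K₁ L d h Mw p ε X Xpos Xneg :=
  add_nonneg (div_nonneg (K₀_nonneg X Xpos Xneg hMw hε) zero_le_two)
    (mul_nonneg (boundOne_nonneg hMw (add_nonneg (mixedNorm_nonneg _ _) hε))
      (add_nonneg (boundInf_nonneg hMw (mixedNorm_nonneg _ _))
        (boundInf_nonneg hMw (mixedNorm_nonneg _ _))))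

/-- Duality with the attacked output in `ℓ_∞` and the difference of outputs in `ℓ₁`. The oscillation
is twice this bound, hence the `2` in `K₀`. -/
theorem abs_margin_le (hd : 1 ≤ d) (hφ : LipschitzWith L φ) (hφ0 : φ 0 = 0)
    (hMw : ∀ l < d, 0 ≤ Mw l) (hW : ∀ l < d, ∀ i, ∑ j, |W l i j| ≤ Mw l) (hp : 1 ≤ p) (hε : 0 ≤ ε)
    (i : Fin M) {x : Fin (h 0) → ℝ} (hx : x ∈ attackSet p ε (X i)) :
    |network φ W d x ⬝ᵥ (network φ W d (Xpos i) - network φ W d (Xneg i))|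
      ≤ K₀ L d h Mw p ε X Xpos Xneg / 2 := by
  have hxn : lpNorm p x ≤ mixedNorm p ∞ X + ε := (lpNorm_le_of_mem_attackSet hp hx).trans
    (add_le_add (lpNorm_row_le_mixedNorm p X i) le_rfl)
  have h1 := (norm_network_le hd hφ hφ0 hMw hW x).trans
    (boundInf_mono hMw ((norm_le_lpNorm hp x).trans hxn))
  have h2 := lpNorm_one_sub_le_add
    ((lpNorm_one_network_le hd hφ hφ0 hMw hW hp (Xpos i)).trans
      (boundOne_mono hMw (lpNorm_row_le_mixedNorm p Xpos i)))
    ((lpNorm_one_network_le hd hφ hφ0 hMw hW hp (Xneg i)).trans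
      (boundOne_mono hMw (lpNorm_row_le_mixedNorm p Xneg i)))
  refine (abs_dotProduct_le_norm_mul _ _).trans ((mul_le_mul h1 h2 (lpNorm_nonneg le_rfl _)
    (boundInf_nonneg hMw (add_nonneg (mixedNorm_nonneg _ _) hε))).trans_eq ?_)
  rw [K₀]
  ring

/-- Product rule: the perturbed factor is always measured in `ℓ_∞` and the other in `ℓ₁`, so only
`ℓ_∞` perturbation bounds are needed. The two terms are those of `K₁`. -/
theorem abs_margin_sub_le (hd : 1 ≤ d) (hφ : LipschitzWith L φ) (hφ0 : φ 0 = 0)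
    (hMw : ∀ l < d, 0 ≤ Mw l) (hW : ∀ l < d, ∀ i, ∑ j, |W l i j| ≤ Mw l)
    (hW' : ∀ l < d, ∀ i, ∑ j, |W' l i j| ≤ Mw l) {δ : ℝ} (hδ : 0 ≤ δ)
    (hWW : ∀ l < d, ∀ i, ∑ j, |W l i j - W' l i j| ≤ Mw l * δ) (hp : 1 ≤ p) (hε : 0 ≤ ε)
    (i : Fin M) {x : Fin (h 0) → ℝ} (hx : x ∈ attackSet p ε (X i)) :
    |network φ W d x ⬝ᵥ (network φ W d (Xpos i) - network φ W d (Xneg i))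
        - network φ W' d x ⬝ᵥ (network φ W' d (Xpos i) - network φ W' d (Xneg i))|
      ≤ d * K₁ L d h Mw p ε X Xpos Xneg * δ := by
  set f := network φ W d with hf
  set g := network φ W' d with hg
  have hxn : lpNorm p x ≤ mixedNorm p ∞ X + ε := (lpNorm_le_of_mem_attackSet hp hx).trans
    (add_le_add (lpNorm_row_le_mixedNorm p X i) le_rfl)
  have hr : 0 ≤ mixedNorm p ∞ X + ε := add_nonneg (mixedNorm_nonneg _ _) hε
  have hdδ : 0 ≤ d * δ := by positivity
  have hdiff : ∀ y, ‖f y - g y‖ ≤ d * δ * boundInf L d Mw (lpNorm p y) := fun y =>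
    (norm_network_sub_le hd hφ hφ0 hMw hW hW' hδ hWW y).trans
      (mul_le_mul_of_nonneg_left (boundInf_mono hMw (norm_le_lpNorm hp y)) hdδ)
  have h1 := (hdiff x).trans (mul_le_mul_of_nonneg_left (boundInf_mono hMw hxn) hdδ)
  have h2 := lpNorm_one_sub_le_add
    ((lpNorm_one_network_le hd hφ hφ0 hMw hW hp (Xpos i)).trans
      (boundOne_mono hMw (lpNorm_row_le_mixedNorm p Xpos i)))
    ((lpNorm_one_network_le hd hφ hφ0 hMw hW hp (Xneg i)).trans
      (boundOne_mono hMw (lpNorm_row_le_mixedNorm p Xneg i)))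
  have h3 := (lpNorm_one_network_le hd hφ hφ0 hMw hW' hp x).trans (boundOne_mono hMw hxn)
  have h4 := norm_sub_le_add
    ((hdiff (Xpos i)).trans (mul_le_mul_of_nonneg_left
      (boundInf_mono hMw (lpNorm_row_le_mixedNorm p Xpos i)) hdδ))
    ((hdiff (Xneg i)).trans (mul_le_mul_of_nonneg_left
      (boundInf_mono hMw (lpNorm_row_le_mixedNorm p Xneg i)) hdδ))
  have e : f x ⬝ᵥ (f (Xpos i) - f (Xneg i)) - g x ⬝ᵥ (g (Xpos i) - g (Xneg i))
      = (f x - g x) ⬝ᵥ (f (Xpos i) - f (Xneg i))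
        + g x ⬝ᵥ ((f (Xpos i) - g (Xpos i)) - (f (Xneg i) - g (Xneg i))) := by
    simp only [sub_dotProduct, dotProduct_sub]
    ring
  rw [e]
  refine (abs_add_le _ _).trans ((add_le_add
    ((abs_dotProduct_le_norm_mul _ _).trans (mul_le_mul h1 h2 (lpNorm_nonneg le_rfl _)
      (mul_nonneg hdδ (boundInf_nonneg hMw hr))))
    ((abs_dotProduct_le_mul_norm _ _).trans (mul_le_mul h3 h4 (norm_nonneg _)
      (boundOne_nonneg hMw hr)))).trans_eq ?_)
  rw [K₁, K₀]
  ring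

end Margin

/-! ### Parametrization by a unit ball -/

/-- Normalised weights of the first `d` layers: the unit ball consists of the families of matrices
with `‖V_l‖_{1,∞} ≤ 1`. -/
abbrev WeightSpace (h : ℕ → ℕ) (d : ℕ) : Type :=
  (l : Fin d) → Fin (h (l + 1)) → PiLp 1 fun _ : Fin (h l) => ℝ

/-- The weights `W_l = M_l V_l`. -/
noncomputable def scaledWeights {h : ℕ → ℕ} (d : ℕ) (Mw : ℕ → ℝ) (V : WeightSpace h d) : Weights h :=
  fun l i j => if hl : l < d then Mw l * V ⟨l, hl⟩ i j else 0

section Parametrization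

variable {h : ℕ → ℕ} {L : ℝ≥0} {φ : ℝ → ℝ} {Mw : ℕ → ℝ} {d : ℕ}

theorem finrank_weightSpace (h : ℕ → ℕ) (d : ℕ) :
    (Module.finrank ℝ (WeightSpace h d) : ℝ) = ∑ l ∈ Finset.range d, (h (l + 1) : ℝ) * (h l : ℝ) := by
  have e : ∀ n : ℕ, Module.finrank ℝ (PiLp 1 fun _ : Fin n => ℝ) = n := fun n => by
    rw [(WithLp.linearEquiv 1 ℝ (Fin n → ℝ)).finrank_eq]
    simp
  simp only [WeightSpace, Module.finrank_pi_fintype, e]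
  rw [← Fin.sum_univ_eq_sum_range fun l => (h (l + 1) : ℝ) * (h l : ℝ)]
  simp

theorem sum_abs_scaledWeights_sub_le (hMw : ∀ l < d, 0 ≤ Mw l) (U V : WeightSpace h d) :
    ∀ l < d, ∀ i, ∑ j, |scaledWeights d Mw U l i j - scaledWeights d Mw V l i j|
      ≤ Mw l * ‖U - V‖ := by
  intro l hl i
  have h1 : ‖(U - V) ⟨l, hl⟩ i‖ ≤ ‖U - V‖ :=
    (norm_le_pi_norm ((U - V) ⟨l, hl⟩) i).trans (norm_le_pi_norm (U - V) ⟨l, hl⟩)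
  rw [PiLp.norm_eq_of_L1] at h1
  refine le_trans (le_of_eq ?_) (mul_le_mul_of_nonneg_left h1 (hMw l hl))
  rw [Finset.mul_sum]
  refine Finset.sum_congr rfl fun j _ => ?_
  simp [scaledWeights, hl, ← mul_sub, abs_mul, abs_of_nonneg (hMw l hl)]

theorem sum_abs_scaledWeights_le (hMw : ∀ l < d, 0 ≤ Mw l) {V : WeightSpace h d} (hV : ‖V‖ ≤ 1) :
    ∀ l < d, ∀ i, ∑ j, |scaledWeights d Mw V l i j| ≤ Mw l := by
  intro l hl i
  have h1 := sum_abs_scaledWeights_sub_le hMw V 0 l hl i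
  rw [sub_zero] at h1
  refine le_trans (le_of_eq ?_) (h1.trans (mul_le_of_le_one_right (hMw l hl) hV))
  simp [scaledWeights]

theorem networkClass_eq_image (hd : 1 ≤ d) (hφ : LipschitzWith L φ) (hφ0 : φ 0 = 0)
    (hMw : ∀ l < d, 0 ≤ Mw l) :
    networkClass φ d h Mw = (fun V : WeightSpace h d => network φ (scaledWeights d Mw V) d) ''
      {V | ‖V‖ ≤ 1} := by
  ext f
  constructor
  · rintro ⟨W, hW, rfl⟩
    have hW' : ∀ l < d, ∀ i, ∑ j, |W l i j| ≤ Mw l := fun l hl =>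
      (mixedNorm_one_top_le_iff (W l) (hMw l hl)).1 (hW l hl)
    -- When `Mw l = 0` the inverse is `0`, which is harmless since then `W l = 0`.
    let V : WeightSpace h d := fun l i => WithLp.toLp 1 fun j => (Mw l)⁻¹ * W l i j
    have hV : ‖V‖ ≤ 1 := by
      refine (pi_norm_le_iff_of_nonneg zero_le_one).2 fun l =>
        (pi_norm_le_iff_of_nonneg zero_le_one).2 fun i => ?_
      have hl := hMw l l.2
      rw [PiLp.norm_eq_of_L1]
      simp only [V, norm_mul, Real.norm_eq_abs, abs_inv, abs_of_nonneg hl]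
      rw [← Finset.mul_sum]
      exact (mul_le_mul_of_nonneg_left (hW' l l.2 i) (inv_nonneg.2 hl)).trans
        inv_mul_le_one
    refine ⟨V, hV, ?_⟩
    -- The two weight families need agree only on the first `d` layers; the perturbation bound with
    -- `δ = 0` identifies their networks.
    have hzero : ∀ l < d, ∀ i, ∑ j, |scaledWeights d Mw V l i j - W l i j| ≤ Mw l * 0 := by
      intro l hl i
      rw [mul_zero]
      refine Finset.sum_nonpos fun j _ => ?_
      have hj : |W l i j| ≤ Mw l := (Finset.single_le_sum (f := fun j => |W l i j|)
        (fun j _ => abs_nonneg _) (Finset.mem_univ j)).trans (hW' l hl i)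
      rcases eq_or_ne (Mw l) 0 with h0 | h0
      · have : W l i j = 0 := abs_nonpos_iff.1 (h0 ▸ hj)
        simp [scaledWeights, hl, h0, this]
      · simp [scaledWeights, hl, V, mul_inv_cancel_left₀ h0]
    funext x
    have := norm_network_sub_le hd hφ hφ0 hMw (sum_abs_scaledWeights_le hMw hV) hW' le_rfl hzero x
    rw [mul_zero, zero_mul] at this
    exact sub_eq_zero.1 (norm_le_zero_iff.1 this)
  · rintro ⟨V, hV, rfl⟩
    exact ⟨_, fun l hl => (mixedNorm_one_top_le_iff _ (hMw l hl)).2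
      (sum_abs_scaledWeights_le hMw hV l hl), rfl⟩

end Parametrization

end AdvContrastive

/-! ### Assembly -/

theorem mainTheorem7 :
    ∃ C : ℝ, 0 < C ∧
      ∀ (M d : ℕ) (_hd : 1 ≤ d) (h : ℕ → ℕ) (Mw : ℕ → ℝ) (_hMw : ∀ l < d, 0 ≤ Mw l)
        (L : ℝ≥0) (φ : ℝ → ℝ) (_hφ : LipschitzWith L φ) (_hφ0 : φ 0 = 0)
        (p : ℝ≥0∞) (_hp : 1 ≤ p) (ε : ℝ) (_hε : 0 ≤ ε)
        (X Xpos Xneg : Matrix (Fin M) (Fin (h 0)) ℝ),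
        -- the minimum in the definition of the class is attained
        (∀ f ∈ AdvContrastive.networkClass φ d h Mw, ∀ z : AdvContrastive.Triple (h 0),
          IsLeast (AdvContrastive.attackedValues p ε f z) (AdvContrastive.advMargin p ε f z)) ∧
        -- the suprema in the Rademacher complexity are finite
        (∀ s : Fin M → ℤˣ,
          BddAbove (AdvContrastive.signedSums
            (AdvContrastive.marginClass p ε (AdvContrastive.networkClass φ d h Mw))
            (fun i => (X i, Xpos i, Xneg i)) s)) ∧
        AdvContrastive.rademacher
            (AdvContrastive.marginClass p ε (AdvContrastive.networkClass φ d h Mw))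
            (fun i => (X i, Xpos i, Xneg i))
          ≤ C * (Real.sqrt (∑ l ∈ Finset.range d, (h (l + 1) : ℝ) * (h l : ℝ))
              * Real.sqrt ((d : ℝ) * AdvContrastive.K₀ L d h Mw p ε X Xpos Xneg
                  * AdvContrastive.K₁ L d h Mw p ε X Xpos Xneg)
              * Real.sqrt (M : ℝ)) := by
  open AdvContrastive in
  refine ⟨7, by norm_num, ?_⟩
  intro M d hd h Mw hMw L φ hφ hφ0 p hp ε hε X Xpos Xneg
  have hcont : ∀ W : Weights h, Continuous (network φ W d) := fun W =>
    continuous_network hφ.continuous W d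
  let G : WeightSpace h d → Fin M → ℝ := fun V i =>
    advMargin p ε (network φ (scaledWeights d Mw V) d) (X i, Xpos i, Xneg i)
  have hK₀ : 0 ≤ K₀ L d h Mw p ε X Xpos Xneg := K₀_nonneg X Xpos Xneg hMw hε
  have hK₁ : 0 ≤ K₁ L d h Mw p ε X Xpos Xneg := K₁_nonneg X Xpos Xneg hMw hε
  have hlip : ∀ U V : WeightSpace h d, ‖U‖ ≤ 1 → ‖V‖ ≤ 1 → ∀ i,
      |G U i - G V i| ≤ d * K₁ L d h Mw p ε X Xpos Xneg * ‖U - V‖ := fun U V hU hV i =>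
    abs_advMargin_sub_le hp hε (hcont _) (hcont _) _ fun x hx =>
      abs_margin_sub_le X Xpos Xneg hd hφ hφ0 hMw (sum_abs_scaledWeights_le hMw hU)
        (sum_abs_scaledWeights_le hMw hV) (norm_nonneg _) (sum_abs_scaledWeights_sub_le hMw U V)
        hp hε i hx
  have hbd : ∀ U V : WeightSpace h d, ‖U‖ ≤ 1 → ‖V‖ ≤ 1 → ∀ i,
      |G U i - G V i| ≤ K₀ L d h Mw p ε X Xpos Xneg := fun U V hU hV i =>
    abs_advMargin_sub_le hp hε (hcont _) (hcont _) _ fun x hx => by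
      have h1 := abs_margin_le X Xpos Xneg hd hφ hφ0 hMw (sum_abs_scaledWeights_le hMw hU) hp hε i hx
      have h2 := abs_margin_le X Xpos Xneg hd hφ hφ0 hMw (sum_abs_scaledWeights_le hMw hV) hp hε i hx
      refine (abs_sub _ _).trans ?_
      linarith
  have hset : ∀ s : Fin M → ℤˣ,
      signedSums (marginClass p ε (networkClass φ d h Mw)) (fun i => (X i, Xpos i, Xneg i)) s
        = (fun V => signedSum s (G V)) '' {V | ‖V‖ ≤ 1} := by
    intro s
    rw [signedSums, marginClass, networkClass_eq_image hd hφ hφ0 hMw, Set.image_image,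
      Set.image_image]
    rfl
  refine ⟨?_, ?_, ?_⟩
  · rintro f ⟨W, -, rfl⟩ z
    exact isLeast_advMargin hp hε (hcont W) z
  · intro s
    rw [hset s]
    -- The oscillation bound, applied between `V` and the centre `0`, controls every signed sum.
    refine ⟨signedSum s (G 0) + M * K₀ L d h Mw p ε X Xpos Xneg, ?_⟩
    rintro _ ⟨V, hV, rfl⟩
    have := (le_abs_self _).trans (abs_signedSum_le s (hbd V 0 hV (by simp)))
    have e := signedSum_sub s (G V) (G 0)
    simp only [signedSum, Pi.sub_apply] at this e ⊢
    linarith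
  · have := signAverage_sSup_closedBall_le G (mul_nonneg (Nat.cast_nonneg d) hK₁) hK₀ hlip hbd
    rw [finrank_weightSpace, mul_right_comm (d : ℝ)] at this
    simp only [rademacher, hset]
    exact this
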